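/- Let $q$ be a prime power, let $V_\infty$ be the $\mathbb F_q$-vector space of all sequences $(\xi_1,\xi_2,\dots)$ with entries in $\mathbb F_q$ and only finitely many nonzero terms, and let $V_n\subset V_\infty$ be the subspace of sequences with $\xi_i=0$ for $i>n$. Let $\mathrm{Gr}(V_\infty)$ be the set of all vector subspaces of $V_\infty$, with the coarsest topology for which each map $X\mapsto X\cap V_n$ ($n\ge 0$) into the discrete set of subspaces of $V_n$ is continuous, and with its Borel $\sigma$-algebra. Let $\mathscr G_\infty=GL(\infty,\mathbb F_q)=\bigcup_n GL(n,\mathbb F_q)$ be the group of invertible infinite matrices over $\mathbb F_q$ that differ from the identity matrix in finitely many entries only; it acts on $V_\infty$, hence on $\mathrm{Gr}(V_\infty)$ by $(g,X)\mapsto g(X)$. Then the ergodic $\mathscr G_\infty$-invariant Borel probability measures on $\mathrm{Gr}(V_\infty)$ are parameterised by $\varkappa\in\{0,1,2,\dots,\infty\}$ as follows. There is a unique family $(P_\varkappa)_{\varkappa\in\{0,1,\dots,\infty\}}$ of measures on $\mathrm{Gr}(V_\infty)$ such that: * $\varkappa\mapsto P_\varkappa$ is a bijection from $\{0,1,2,\dots,\infty\}$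 onto the set of ergodic $\mathscr G_\infty$-invariant probability measures on $\mathrm{Gr}(V_\infty)$; * $P_0$ is the Dirac mass at $V_\infty$; * $P_\infty$ is the Dirac mass at $\{0\}$; * for $0<\varkappa<\infty$, $P_\varkappa$ is supported by the set of subspaces of codimension $\varkappa$ in $V_\infty$, i.e. the complement of this set has $P_\varkappa$-measure $0$. -/

import Mathlib

open MeasureTheory

namespace QGrassmannian

/-- The space `V_∞` of finitely supported sequences with entries in `F`. -/
abbrev Vinf (F : Type*) [Field F] : Type _ := ℕ →₀ F

/-- The subspace `V_n ⊆ V_∞` of sequences whose coordinates vanish outside the first `n` places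
(coordinates are indexed by `0, 1, 2, …`). -/
def V (F : Type*) [Field F] (n : ℕ) : Submodule F (Vinf F) :=
  Finsupp.supported F F (Set.Iio n)

/-- The Grassmannian `Gr(V_∞)`: the set of all vector subspaces of `V_∞`. -/
abbrev Gr (F : Type*) [Field F] : Type _ := Submodule F (Vinf F)

/-- The projective limit topology on `Gr(V_∞)`: the coarsest topology for which all the maps
`X ↦ X ∩ V_n` are continuous, their values being taken in a discrete space. -/
noncomputable instance instTopologicalSpaceGr (F : Type*) [Field F] : TopologicalSpace (Gr F) :=
  ⨅ n : ℕ, TopologicalSpace.induced (fun X : Gr F => X ⊓ V F n) ⊥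

/-- `Gr(V_∞)` carries its Borel σ-algebra. -/
noncomputable instance instMeasurableSpaceGr (F : Type*) [Field F] : MeasurableSpace (Gr F) :=
  borel (Gr F)

instance instBorelSpaceGr (F : Type*) [Field F] : BorelSpace (Gr F) := ⟨rfl⟩

/-- The group `𝒢_n = GL(n, F)`, realised as the group of those invertible linear transformations
of `V_∞` whose matrix agrees with the identity matrix outside the upper left `n × n` block: the
columns with index `≥ n` and the rows with index `≥ n` are those of the identity. -/
def GLn (F : Type*) [Field F] (n : ℕ) : Subgroup (Vinf F ≃ₗ[F] Vinf F) where
  carrier := {g | (∀ j, n ≤ j → g (Finsupp.single j 1) = Finsupp.single j 1) ∧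
    ∀ i, n ≤ i → ∀ v : Vinf F, g v i = v i}
  one_mem' := ⟨fun _ _ => rfl, fun _ _ _ => rfl⟩
  mul_mem' := by
    rintro g h ⟨hg₁, hg₂⟩ ⟨hh₁, hh₂⟩
    refine ⟨fun j hj => ?_, fun i hi v => ?_⟩
    · rw [LinearEquiv.mul_apply, hh₁ j hj, hg₁ j hj]
    · rw [LinearEquiv.mul_apply, hg₂ i hi, hh₂ i hi]
  inv_mem' := by
    rintro g ⟨hg₁, hg₂⟩
    refine ⟨fun j hj => ?_, fun i hi v => ?_⟩
    · exact (LinearEquiv.symm_apply_eq g).2 (hg₁ j hj).symm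
    · have h := hg₂ i hi (g.symm v)
      rw [LinearEquiv.apply_symm_apply] at h
      exact h.symm

theorem GLn_mono (F : Type*) [Field F] {m n : ℕ} (h : m ≤ n) : GLn F m ≤ GLn F n :=
  fun _ hg => ⟨fun j hj => hg.1 j (h.trans hj), fun i hi => hg.2 i (h.trans hi)⟩

/-- The group `𝒢_∞ = ⋃ₙ 𝒢_n = GL(∞, F)`. -/
def GLinf (F : Type*) [Field F] : Subgroup (Vinf F ≃ₗ[F] Vinf F) where
  carrier := {g | ∃ n : ℕ, g ∈ GLn F n}
  one_mem' := ⟨0, (GLn F 0).one_mem⟩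
  mul_mem' := by
    rintro g h ⟨m, hm⟩ ⟨n, hn⟩
    exact ⟨max m n, (GLn F (max m n)).mul_mem (GLn_mono F (le_max_left m n) hm)
      (GLn_mono F (le_max_right m n) hn)⟩
  inv_mem' := by
    rintro g ⟨n, hn⟩
    exact ⟨n, (GLn F n).inv_mem hn⟩

/-- The action of `𝒢_∞` on `Gr(V_∞)`: `g` sends a subspace `X` to its image `g(X)`. -/
noncomputable instance instMulActionGr (F : Type*) [Field F] : MulAction (GLinf F) (Gr F) where
  smul g X := X.map ((g : Vinf F ≃ₗ[F] Vinf F) : Vinf F →ₗ[F] Vinf F)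
  one_smul X := Submodule.map_id X
  mul_smul g h X := Submodule.map_comp _ _ X

/-- An ergodic `𝒢_∞`-invariant Borel probability measure on `Gr(V_∞)`. -/
def IsErgodicInvariant (F : Type*) [Field F] (μ : Measure (Gr F)) : Prop :=
  IsProbabilityMeasure μ ∧ ErgodicSMul (GLinf F) (Gr F) μ

/-- The codimension of a subspace `X` of `V_∞`, i.e. the dimension of `V_∞ / X`, as a cardinal. -/
noncomputable def codim (F : Type*) [Field F] (X : Gr F) : Cardinal :=
  Module.rank F (Vinf F ⧸ X)

end QGrassmannian

/-! The group `GLn F n` is transitive on subspaces of `V_n` of a given dimension, so an invariant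
measure is uniform on the values of `X ∩ V_n` of each dimension. The codimension `codimAt n X` of `X
∩ V_n` in `V_n` is nondecreasing in `n`; it stabilises at `k` exactly when `X` has codimension `k`,
and tends to infinity when the codimension is infinite.

Uniqueness on codimension `k` (`eq_of_codim_eq`): given `codimAt n X = k`, the law of `X ∩ V_n` is
uniform and hence common to all invariant measures; the conditioning event has mass tending to 1.
Ergodicity follows, since conditioning on an almost invariant set yields another invariant measure
of the same kind.

Infinite codimension (`eq_dirac_bot`): by uniformity a fixed nonzero vector lies in `X` with
probability at most a constant times the mean of `q ^ (-codimAt n X)`, which tends to 0, so `X = 0`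
almost surely.

Existence (`exists_invariant_codim_eq`): take the kernel of a Haar-random linear map from `V_∞` to
`F^k`, which is almost surely onto.

Codimension being invariant, an ergodic measure lives on one finite codimension or on infinite
codimension, which completes the list. -/

namespace QGrassmannian

open Filter Topology

/-! ### Transitivity of `GL(n)` and finite-level codimensions -/

section LinearAlgebra

/-- Two finite dimensional subspaces of the same dimension inside `U` are exchanged by an
automorphism preserving `U` and fixing a given complement of `U` pointwise. -/
theorem exists_linearEquiv_map_eq {K E : Type*} [Field K] [AddCommGroup E] [Module K E]
    {U W p p' : Submodule K E} [FiniteDimensional K U] (hUW : IsCompl U W) (hp : p ≤ U)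
    (hp' : p' ≤ U) (h : Module.finrank K p = Module.finrank K p') :
    ∃ g : E ≃ₗ[K] E, p.map (g : E →ₗ[K] E) = p' ∧ (∀ u ∈ U, g u ∈ U) ∧ ∀ w ∈ W, g w = w := by
  obtain ⟨C, hC⟩ := (p.comap U.subtype).exists_isCompl
  obtain ⟨C', hC'⟩ := (p'.comap U.subtype).exists_isCompl
  have h1 : Module.finrank K (p.comap U.subtype) = Module.finrank K (p'.comap U.subtype) := by
    rw [(Submodule.comapSubtypeEquivOfLe hp).finrank_eq,
      (Submodule.comapSubtypeEquivOfLe hp').finrank_eq, h]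
  have h2 : Module.finrank K C = Module.finrank K C' := by
    have := Submodule.finrank_add_eq_of_isCompl hC
    have := Submodule.finrank_add_eq_of_isCompl hC'
    omega
  let e : U ≃ₗ[K] U := (Submodule.prodEquivOfIsCompl _ _ hC).symm ≪≫ₗ
    ((LinearEquiv.ofFinrankEq _ _ h1).prodCongr (LinearEquiv.ofFinrankEq _ _ h2)) ≪≫ₗ
    Submodule.prodEquivOfIsCompl _ _ hC'
  have he : ∀ x : U, (x : E) ∈ p → (e x : E) ∈ p' := by
    intro x hx
    have hx' : (Submodule.prodEquivOfIsCompl _ _ hC).symm x =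
        (⟨x, hx⟩, 0) := by
      rw [LinearEquiv.symm_apply_eq]; simp
    simp only [e, LinearEquiv.trans_apply, hx', LinearEquiv.prodCongr_apply, map_zero,
      Submodule.coe_prodEquivOfIsCompl', ZeroMemClass.coe_zero, add_zero]
    exact (LinearEquiv.ofFinrankEq _ _ h1 ⟨x, hx⟩).2
  let g : E ≃ₗ[K] E := (Submodule.prodEquivOfIsCompl _ _ hUW).symm ≪≫ₗ
    (e.prodCongr (LinearEquiv.refl K W)) ≪≫ₗ Submodule.prodEquivOfIsCompl _ _ hUW
  have hgU : ∀ u : U, g u = e u := by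
    intro u
    have : (Submodule.prodEquivOfIsCompl _ _ hUW).symm (u : E) = (u, 0) := by
      rw [LinearEquiv.symm_apply_eq]; simp
    simp [g, this]
  have hgW : ∀ w : W, g w = w := by
    intro w
    have : (Submodule.prodEquivOfIsCompl _ _ hUW).symm (w : E) = (0, w) := by
      rw [LinearEquiv.symm_apply_eq]; simp
    simp [g, this]
  have hfin : FiniteDimensional K p' := Submodule.finiteDimensional_of_le hp'
  refine ⟨g, ?_, fun u hu => ?_, fun w hw => hgW ⟨w, hw⟩⟩
  · apply Submodule.eq_of_le_of_finrank_eq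
    · rintro _ ⟨x, hx, rfl⟩
      have := hgU ⟨x, hp hx⟩
      simp only [LinearEquiv.coe_coe, this]
      exact he _ hx
    · exact (LinearEquiv.finrank_map_eq g p).trans h
  · rw [hgU ⟨u, hu⟩]; exact (e ⟨u, hu⟩).2

variable (F : Type*) [Field F]

theorem mem_V {n : ℕ} {v : Vinf F} : v ∈ V F n ↔ ∀ i, n ≤ i → v i = 0 := by
  rw [V, Finsupp.mem_supported']
  simp

theorem V_mono : Monotone (V F) := fun _ _ h _ hv =>
  (mem_V F).2 fun i hi => (mem_V F).1 hv i (h.trans hi)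

theorem exists_mem_V (v : Vinf F) : ∃ n, v ∈ V F n := by
  obtain ⟨n, hn⟩ := v.support.exists_nat_subset_range
  refine ⟨n, (mem_V F).2 fun i hi => ?_⟩
  by_contra h
  have := hn (Finsupp.mem_support_iff.2 h)
  simp only [Finset.mem_range] at this
  omega

instance finiteDimensional_V (n : ℕ) : FiniteDimensional F (V F n) :=
  Module.Finite.equiv (Finsupp.supportedEquivFinsupp (M := F) (R := F) (Set.Iio n)).symm

theorem finrank_V (n : ℕ) : Module.finrank F (V F n) = n := by
  rw [V, (Finsupp.supportedEquivFinsupp (M := F) (R := F) (Set.Iio n)).finrank_eq,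
    Module.finrank_finsupp_self]
  simp

instance finite_V [Finite F] (n : ℕ) : Finite (V F n) := Module.finite_of_finite F

theorem isCompl_V (n : ℕ) : IsCompl (V F n) (Finsupp.supported F F (Set.Ici n)) := by
  have h : (Set.Ici n) = (Set.Iio n)ᶜ := by simp
  refine ⟨Finsupp.disjoint_supported_supported ?_, Finsupp.codisjoint_supported_supported ?_⟩
  · rw [h]; exact disjoint_compl_right
  · rw [h]; exact codisjoint_iff.2 sup_compl_eq_top

variable {F}

theorem GLn_apply_mem_V_iff {n : ℕ} {g : Vinf F ≃ₗ[F] Vinf F} (hg : g ∈ GLn F n) {v : Vinf F} :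
    g v ∈ V F n ↔ v ∈ V F n := by
  rw [mem_V, mem_V]
  exact forall₂_congr fun i hi => by rw [hg.2 i hi]

theorem exists_GLn_map_eq {n : ℕ} {Z Z' : Gr F} (hZ : Z ≤ V F n) (hZ' : Z' ≤ V F n)
    (h : Module.finrank F Z = Module.finrank F Z') :
    ∃ g ∈ GLn F n, Z.map (g : Vinf F →ₗ[F] Vinf F) = Z' := by
  obtain ⟨g, hg, hU, hW⟩ := exists_linearEquiv_map_eq (isCompl_V F n) hZ hZ' h
  refine ⟨g, ⟨fun j hj => hW _ (Finsupp.single_mem_supported F 1 hj), fun i hi v => ?_⟩, hg⟩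
  obtain ⟨u, hu, w, hw, rfl⟩ := Submodule.mem_sup.1
    (show v ∈ V F n ⊔ Finsupp.supported F F (Set.Ici n) by
      rw [(isCompl_V F n).sup_eq_top]; trivial)
  rw [map_add, hW w hw, Finsupp.add_apply, Finsupp.add_apply, (mem_V F).1 hu i hi,
    (mem_V F).1 (hU u hu) i hi]

theorem mem_smul_iff {g : GLinf F} {X : Gr F} {v : Vinf F} :
    v ∈ g • X ↔ (g : Vinf F ≃ₗ[F] Vinf F).symm v ∈ X :=
  Submodule.mem_map_equiv _

theorem smul_inf_V_eq_iff {n : ℕ} {g : GLinf F} (hg : (g : Vinf F ≃ₗ[F] Vinf F) ∈ GLn F n)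
    {X Z : Gr F} : (g • X) ⊓ V F n = g • Z ↔ X ⊓ V F n = Z := by
  have : (g • X) ⊓ V F n = g • (X ⊓ V F n) := by
    ext v
    rw [Submodule.mem_inf, mem_smul_iff, mem_smul_iff, Submodule.mem_inf,
      ← GLn_apply_mem_V_iff hg (v := (g : Vinf F ≃ₗ[F] Vinf F).symm v),
      LinearEquiv.apply_symm_apply]
  rw [this]
  exact smul_left_cancel_iff g

theorem codim_smul (g : GLinf F) (X : Gr F) : codim F (g • X) = codim F X :=
  (Submodule.Quotient.equiv X (g • X) (g : Vinf F ≃ₗ[F] Vinf F) rfl).rank_eq.symm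

/-- The codimension of `X ∩ V_n` in `V_n`, as the dimension of the image of `V_n` in `V_∞ / X`. -/
noncomputable def codimAt (n : ℕ) (X : Gr F) : ℕ := Module.finrank F ((V F n).map X.mkQ)

theorem codimAt_add_finrank (n : ℕ) (X : Gr F) :
    codimAt n X + Module.finrank F (X ⊓ V F n : Gr F) = n := by
  have h := LinearMap.finrank_range_add_finrank_ker (K := F) (V := V F n) (V₂ := Vinf F ⧸ X)
    (X.mkQ.domRestrict (V F n))
  rwa [finrank_V, LinearMap.range_domRestrict, LinearMap.ker_domRestrict, Submodule.ker_mkQ,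
    ← LinearEquiv.finrank_eq (Submodule.equivSubtypeMap (V F n) (X.comap (V F n).subtype)).symm,
    Submodule.map_comap_subtype, inf_comm] at h

theorem codimAt_mono (X : Gr F) : Monotone fun n => codimAt n X := fun _ _ h =>
  Submodule.finrank_mono (Submodule.map_mono (V_mono F h))

/-- The images of the `V_n` exhaust `V_∞ / X` increasingly, so any finite independent family already
lies in one of them. -/
theorem codim_le_iff {X : Gr F} {k : ℕ} : codim F X ≤ k ↔ ∀ n, codimAt n X ≤ k := by
  constructor
  · intro h n
    have := (Submodule.rank_le ((V F n).map X.mkQ)).trans h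
    rw [← Module.finrank_eq_rank] at this
    exact_mod_cast this
  · intro h
    refine rank_le fun s hs => ?_
    have hdir : Directed (· ⊆ ·) fun n => (((V F n).map X.mkQ : Submodule F _) : Set (Vinf F ⧸ X)) :=
      Monotone.directed_le fun _ _ h => Submodule.map_mono (V_mono F h)
    obtain ⟨n, hn⟩ := hdir.exists_mem_subset_of_finset_subset_biUnion (s := s) (by
      intro x _
      obtain ⟨v, rfl⟩ := X.mkQ_surjective x
      obtain ⟨n, hn⟩ := exists_mem_V F v
      exact Set.mem_iUnion.2 ⟨n, v, hn, rfl⟩)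
    refine le_trans ?_ (h n)
    have hs' : LinearIndependent F fun i : s => (⟨i, hn i.2⟩ : (V F n).map X.mkQ) :=
      LinearIndependent.of_comp ((V F n).map X.mkQ).subtype hs
    simpa [codimAt] using hs'.fintype_card_le_finrank

theorem codim_eq_iff {X : Gr F} {k : ℕ} :
    codim F X = k ↔ ∀ᶠ n in atTop, codimAt n X = k := by
  constructor
  · intro h
    have hle := codim_le_iff.1 h.le
    have : ∃ n, k ≤ codimAt n X := by
      by_contra! hlt
      obtain _ | j := k
      · exact absurd (hlt 0) (by simp)
      · have := codim_le_iff.2 fun n => Nat.lt_succ_iff.1 (hlt n)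
        rw [h] at this
        have : j + 1 ≤ j := by exact_mod_cast this
        omega
    obtain ⟨m, hm⟩ := this
    filter_upwards [eventually_ge_atTop m] with n hn
    exact le_antisymm (hle n) (hm.trans (codimAt_mono X hn))
  · intro h
    obtain ⟨N, hN⟩ := eventually_atTop.1 h
    have hle : codim F X ≤ k := codim_le_iff.2 fun n =>
      (codimAt_mono X (le_max_left n N)).trans (hN _ (le_max_right n N)).le
    obtain ⟨j, hj⟩ := Cardinal.lt_aleph0.1 (hle.trans_lt (Cardinal.natCast_lt_aleph0))
    have h1 := codim_le_iff.1 hj.le N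
    rw [hN N le_rfl] at h1
    rw [hj] at hle ⊢
    have : j ≤ k := by exact_mod_cast hle
    rw [le_antisymm this h1]

theorem tendsto_codimAt_atTop {X : Gr F} (h : ∀ k : ℕ, codim F X ≠ k) :
    Tendsto (fun n => codimAt n X) atTop atTop := by
  refine tendsto_atTop_atTop_of_monotone (codimAt_mono X) fun k => ?_
  by_contra! hlt
  have := codim_le_iff.2 fun n => (hlt n).le
  obtain ⟨j, hj⟩ := Cardinal.lt_aleph0.1 (this.trans_lt (Cardinal.natCast_lt_aleph0))
  exact h j hj

end LinearAlgebra

/-! ### Cylinder sets and the Borel structure -/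

section Topology

variable {F : Type*} [Field F]

theorem isOpen_inf_V_preimage (n : ℕ) (A : Set (Gr F)) : IsOpen {X : Gr F | X ⊓ V F n ∈ A} := by
  have h : instTopologicalSpaceGr F ≤ TopologicalSpace.induced (fun X : Gr F => X ⊓ V F n) ⊥ :=
    iInf_le _ n
  exact h _ ⟨A, trivial, rfl⟩

theorem measurableSet_inf_V_preimage (n : ℕ) (A : Set (Gr F)) :
    MeasurableSet {X : Gr F | X ⊓ V F n ∈ A} := (isOpen_inf_V_preimage n A).measurableSet

theorem measurable_codimAt (n : ℕ) : Measurable (codimAt (F := F) n) := by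
  refine measurable_to_countable' fun k => ?_
  -- The subtraction is not truncated at `Z = X ⊓ V F n`, whose dimension is at most `n`.
  convert measurableSet_inf_V_preimage n {Z : Gr F | n - Module.finrank F Z = k} using 1
  ext X
  have := codimAt_add_finrank n X
  simp only [Set.mem_preimage, Set.mem_singleton_iff, Set.mem_ofPred_eq]
  omega

theorem measurableSet_codim_eq (k : ℕ) : MeasurableSet {X : Gr F | codim F X = k} := by
  have : {X : Gr F | codim F X = k} = ⋃ N, ⋂ n ≥ N, codimAt n ⁻¹' {k} := by
    ext X
    simp [codim_eq_iff]
  rw [this]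
  exact MeasurableSet.iUnion fun N => MeasurableSet.iInter fun n => MeasurableSet.iInter fun _ =>
    measurable_codimAt n (measurableSet_singleton k)

theorem measurableSet_mem (v : Vinf F) : MeasurableSet {X : Gr F | v ∈ X} := by
  obtain ⟨n, hn⟩ := exists_mem_V F v
  convert measurableSet_inf_V_preimage n {Z : Gr F | v ∈ Z} using 1
  ext X
  simp [hn]

/-- `X ∩ V_n` determines `X ∩ V_m` for `m ≤ n`, so the defining infimum is directed and a single
level suffices. -/
theorem mem_nhds_Gr {X : Gr F} {U : Set (Gr F)} (hU : U ∈ 𝓝 X) :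
    ∃ n, {Y : Gr F | Y ⊓ V F n = X ⊓ V F n} ⊆ U := by
  have h : @nhds (Gr F) (instTopologicalSpaceGr F) X =
      ⨅ n, 𝓟 {Y : Gr F | Y ⊓ V F n = X ⊓ V F n} := by
    rw [instTopologicalSpaceGr, nhds_iInf]
    refine iInf_congr fun n => ?_
    let : TopologicalSpace (Gr F) := ⊥
    have : DiscreteTopology (Gr F) := ⟨rfl⟩
    rw [nhds_induced, nhds_discrete, ← principal_singleton, comap_principal]
    rfl
  rw [h, mem_iInf_of_directed] at hU
  · exact hU
  · refine directed_of_isDirected_le fun m n hmn => ?_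
    refine principal_mono.2 fun Y (hY : _ = _) => ?_
    have := congrArg (· ⊓ V F m) hY
    simpa only [inf_assoc, inf_eq_right.2 (V_mono F hmn), Set.mem_ofPred_eq] using this

/-- The cylinder sets `{X | X ∩ V_n = Z}`. -/
def cylinders (F : Type*) [Field F] : Set (Set (Gr F)) :=
  {S | ∃ (n : ℕ) (Z : Gr F), Z ≤ V F n ∧ S = {X | X ⊓ V F n = Z}}

theorem isOpen_of_mem_cylinders {S : Set (Gr F)} (hS : S ∈ cylinders F) : IsOpen S := by
  obtain ⟨n, Z, -, rfl⟩ := hS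
  exact isOpen_inf_V_preimage n {Z}

theorem isTopologicalBasis_cylinders :
    TopologicalSpace.IsTopologicalBasis (cylinders F) := by
  refine TopologicalSpace.isTopologicalBasis_of_isOpen_of_nhds
    (fun _ => isOpen_of_mem_cylinders) fun X U hX hU => ?_
  obtain ⟨n, hn⟩ := mem_nhds_Gr (hU.mem_nhds hX)
  exact ⟨_, ⟨n, X ⊓ V F n, inf_le_right, rfl⟩, rfl, hn⟩

theorem isPiSystem_cylinders : IsPiSystem (cylinders F) := by
  have key : ∀ (m n : ℕ) (Y Z : Gr F), Z ≤ V F n → m ≤ n →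
      ({X : Gr F | X ⊓ V F m = Y} ∩ {X | X ⊓ V F n = Z}).Nonempty →
      {X : Gr F | X ⊓ V F m = Y} ∩ {X | X ⊓ V F n = Z} ∈ cylinders F := by
    rintro m n Y Z hZ hmn ⟨X, hX : _ = _, hX' : _ = _⟩
    refine ⟨n, Z, hZ, Set.inter_eq_right.2 fun W (hW : _ = _) => ?_⟩
    rw [← hX'] at hW
    have := congrArg (· ⊓ V F m) hW
    simp only [inf_assoc, inf_eq_right.2 (V_mono F hmn)] at this
    exact this.trans hX
  rintro _ ⟨m, Y, hY, rfl⟩ _ ⟨n, Z, hZ, rfl⟩ h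
  obtain hmn | hmn := le_total m n
  · exact key m n Y Z hZ hmn h
  · rw [Set.inter_comm] at h ⊢
    exact key n m Z Y hY hmn h

variable [Finite F]

theorem finite_setOf_le_V (n : ℕ) : {Z : Gr F | Z ≤ V F n}.Finite := by
  refine Set.Finite.of_finite_image (f := fun Z : Gr F => (Z : Set (Vinf F)))
    ((show (V F n : Set (Vinf F)).Finite from finite_V F n).finite_subsets.subset ?_)
    SetLike.coe_injective.injOn
  rintro _ ⟨Z, hZ, rfl⟩
  exact hZ

theorem countable_cylinders : (cylinders F).Countable := by
  have : cylinders F = ⋃ n : ℕ, (fun Z : Gr F => {X : Gr F | X ⊓ V F n = Z}) '' {Z | Z ≤ V F n} := by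
    ext S
    simp [cylinders, eq_comm]
  rw [this]
  exact Set.countable_iUnion fun n => (finite_setOf_le_V n).countable.image _

instance secondCountableTopology_Gr : SecondCountableTopology (Gr F) :=
  isTopologicalBasis_cylinders.secondCountableTopology countable_cylinders

theorem generateFrom_cylinders :
    instMeasurableSpaceGr F = MeasurableSpace.generateFrom (cylinders F) :=
  isTopologicalBasis_cylinders.borel_eq_generateFrom

/-- Since `V_n` is finite, a cylinder is cut out by finitely many membership conditions. -/
theorem measurable_of_measurableSet_mem {α : Type*} [MeasurableSpace α] {f : α → Gr F}
    (hf : ∀ v, MeasurableSet {a | v ∈ f a}) : Measurable f := by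
  rw [generateFrom_cylinders]
  refine measurable_generateFrom ?_
  rintro _ ⟨n, Z, hZ, rfl⟩
  have : f ⁻¹' {X | X ⊓ V F n = Z} = ⋂ v : V F n, {a | (v : Vinf F) ∈ f a ↔ (v : Vinf F) ∈ Z} := by
    ext a
    simp only [Set.mem_preimage, Set.mem_ofPred_eq, Set.mem_iInter, SetLike.ext_iff,
      Submodule.mem_inf, Subtype.forall]
    refine forall_congr' fun v => ⟨fun h hv => by simpa [hv] using h, fun h => ?_⟩
    by_cases hv : v ∈ V F n
    · simpa [hv] using h hv
    · simpa [hv] using fun h' => hv (hZ h')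
  rw [this]
  exact MeasurableSet.iInter fun v => (hf v).iff (MeasurableSet.const _)

theorem measurable_smul_Gr (g : GLinf F) : Measurable fun X : Gr F => g • X :=
  measurable_of_measurableSet_mem fun v => by
    simp only [mem_smul_iff]
    exact measurableSet_mem _

end Topology

end QGrassmannian

namespace QGrassmannian

open Filter Topology

/-! ### Invariant measures: uniqueness, ergodicity, infinite codimension -/

section Invariant

variable {F : Type*} [Field F]

theorem measure_cylinder_eq {μ : Measure (Gr F)} [SMulInvariantMeasure (GLinf F) (Gr F) μ]
    {n : ℕ} {Z Z' : Gr F} (hZ : Z ≤ V F n) (hZ' : Z' ≤ V F n)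
    (h : Module.finrank F Z = Module.finrank F Z') :
    μ {X | X ⊓ V F n = Z} = μ {X | X ⊓ V F n = Z'} := by
  obtain ⟨g, hg, rfl⟩ := exists_GLn_map_eq hZ hZ' h
  let γ : GLinf F := ⟨g, n, hg⟩
  have hm : MeasurableSet {X | X ⊓ V F n = Z.map (g : Vinf F →ₗ[F] Vinf F)} :=
    measurableSet_inf_V_preimage n {Z.map (g : Vinf F →ₗ[F] Vinf F)}
  rw [← SMulInvariantMeasure.measure_preimage_smul γ hm]
  congr 1
  ext X
  exact (smul_inf_V_eq_iff (g := γ) hg).symm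

theorem measure_mem_eq {μ : Measure (Gr F)} [SMulInvariantMeasure (GLinf F) (Gr F) μ]
    {v w : Vinf F} (hv : v ≠ 0) (hw : w ≠ 0) : μ {X | v ∈ X} = μ {X | w ∈ X} := by
  obtain ⟨a, ha⟩ := exists_mem_V F v
  obtain ⟨b, hb⟩ := exists_mem_V F w
  obtain ⟨g, hg, hvw⟩ := exists_GLn_map_eq (n := max a b) (Z := F ∙ v) (Z' := F ∙ w)
    ((Submodule.span_singleton_le_iff_mem _ _).2 (V_mono F (le_max_left a b) ha))
    ((Submodule.span_singleton_le_iff_mem _ _).2 (V_mono F (le_max_right a b) hb))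
    (by rw [finrank_span_singleton hv, finrank_span_singleton hw])
  let γ : GLinf F := ⟨g, _, hg⟩
  rw [← SMulInvariantMeasure.measure_preimage_smul γ (measurableSet_mem w)]
  congr 1
  ext X
  change v ∈ X ↔ w ∈ γ • X
  rw [← Submodule.span_singleton_le_iff_mem w, ← hvw, ← Submodule.span_singleton_le_iff_mem v]
  exact (Submodule.map_le_map_iff_of_injective g.injective _ _).symm

/-- The measure of a set of subspaces `X` depending only on `X ∩ V_n`, with `X ∩ V_n` of constant
dimension, is the number of admissible values of `X ∩ V_n` times the measure of one cylinder. -/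
theorem measure_inf_V_preimage {μ : Measure (Gr F)} [SMulInvariantMeasure (GLinf F) (Gr F) μ]
    {n : ℕ} {Z₀ : Gr F} (hZ₀ : Z₀ ≤ V F n) (T : Finset (Gr F))
    (hT : ∀ Z ∈ T, Z ≤ V F n ∧ Module.finrank F Z = Module.finrank F Z₀) :
    μ {X | X ⊓ V F n ∈ T} = T.card * μ {X | X ⊓ V F n = Z₀} := by
  have h : {X : Gr F | X ⊓ V F n ∈ T} = ⋃ Z ∈ T, {X | X ⊓ V F n = Z} := by
    ext X; simp
  rw [h, measure_biUnion_finset]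
  · rw [Finset.sum_congr rfl fun Z hZ => measure_cylinder_eq (hT Z hZ).1 hZ₀ (hT Z hZ).2,
      Finset.sum_const, nsmul_eq_mul]
  · intro Z _ Z' _ hne
    exact Set.disjoint_left.2 fun X (h1 : _ = _) (h2 : _ = _) => hne (h1.symm.trans h2)
  · exact fun Z _ => measurableSet_inf_V_preimage n {Z}

theorem tendsto_measure_inter_codimAt {μ : Measure (Gr F)} [IsProbabilityMeasure μ] {k : ℕ}
    (hμ : μ {X | codim F X = k}ᶜ = 0) {A : Set (Gr F)} (hA : MeasurableSet A) :
    Tendsto (fun n => μ (A ∩ codimAt n ⁻¹' {k})) atTop (𝓝 (μ A)) := by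
  refine tendsto_measure_of_ae_tendsto_indicator_of_isFiniteMeasure atTop hA
    (fun n => hA.inter (measurable_codimAt n (measurableSet_singleton k))) ?_
  have : ∀ᵐ X ∂μ, codim F X = k := hμ
  filter_upwards [this] with X hX
  filter_upwards [codim_eq_iff.1 hX] with n hn
  simp [hn]

variable [Finite F]

/-- Equality of the conditional laws of `X ∩ V_n` given `codimAt n X = k`, cross-multiplied because
the conditioning events may be null. Both sides count the same subspaces. -/
theorem measure_inter_mul_comm (μ ν : Measure (Gr F)) [SMulInvariantMeasure (GLinf F) (Gr F) μ]
    [SMulInvariantMeasure (GLinf F) (Gr F) ν] {n : ℕ} (k : ℕ) (A : Set (Gr F)) :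
    μ ({X | X ⊓ V F n ∈ A} ∩ codimAt n ⁻¹' {k}) * ν (codimAt n ⁻¹' {k}) =
      ν ({X | X ⊓ V F n ∈ A} ∩ codimAt n ⁻¹' {k}) * μ (codimAt n ⁻¹' {k}) := by
  classical
  obtain h | ⟨X₀, hX₀⟩ := (codimAt n ⁻¹' {k} : Set (Gr F)).eq_empty_or_nonempty
  · simp [h]
  let S : Finset (Gr F) := (finite_setOf_le_V n).toFinset.filter
    fun Z => Module.finrank F Z = Module.finrank F (X₀ ⊓ V F n : Gr F)
  have hS : ∀ Z, Z ∈ S ↔ Z ≤ V F n ∧ Module.finrank F Z = Module.finrank F (X₀ ⊓ V F n : Gr F) :=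
    fun Z => by simp [S]
  have h0 : X₀ ⊓ V F n ≤ V F n := inf_le_right
  have h1 : (codimAt n ⁻¹' {k} : Set (Gr F)) = {X | X ⊓ V F n ∈ S} := by
    ext X
    have h2 := codimAt_add_finrank n X
    have h3 := codimAt_add_finrank n X₀
    have h4 : codimAt n X₀ = k := hX₀
    simp only [Set.mem_preimage, Set.mem_singleton_iff, Set.mem_ofPred_eq, hS, inf_le_right,
      true_and]
    omega
  have h2 : ({X | X ⊓ V F n ∈ A} ∩ codimAt n ⁻¹' {k} : Set (Gr F)) =
      {X | X ⊓ V F n ∈ S.filter (· ∈ A)} := by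
    rw [h1]
    ext X
    simp [and_comm]
  have hS' : ∀ Z ∈ S.filter (· ∈ A),
      Z ≤ V F n ∧ Module.finrank F Z = Module.finrank F (X₀ ⊓ V F n : Gr F) :=
    fun Z hZ => (hS Z).1 (Finset.mem_filter.1 hZ).1
  rw [h2, h1, measure_inf_V_preimage h0 _ hS', measure_inf_V_preimage h0 _ hS',
    measure_inf_V_preimage h0 S fun Z => (hS Z).1, measure_inf_V_preimage h0 S fun Z => (hS Z).1]
  ring

/-- There is at most one invariant probability measure on the subspaces of codimension `k`. -/
theorem eq_of_codim_eq {μ ν : Measure (Gr F)} [IsProbabilityMeasure μ] [IsProbabilityMeasure ν]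
    [SMulInvariantMeasure (GLinf F) (Gr F) μ] [SMulInvariantMeasure (GLinf F) (Gr F) ν] {k : ℕ}
    (hμ : μ {X | codim F X = k}ᶜ = 0) (hν : ν {X | codim F X = k}ᶜ = 0) : μ = ν := by
  refine ext_of_generate_finite _ generateFrom_cylinders isPiSystem_cylinders ?_ (by simp)
  rintro _ ⟨m, Z, hZ, rfl⟩
  have hE : MeasurableSet {X : Gr F | X ⊓ V F m = Z} := measurableSet_inf_V_preimage m {Z}
  -- The second factor tends to 1; it is kept so that `measure_inter_mul_comm` exchanges the two
  -- measures.
  have key : ∀ {μ ν : Measure (Gr F)} [IsProbabilityMeasure μ] [IsProbabilityMeasure ν],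
      μ {X | codim F X = k}ᶜ = 0 → ν {X | codim F X = k}ᶜ = 0 →
      Tendsto (fun n => μ ({X | X ⊓ V F m = Z} ∩ codimAt n ⁻¹' {k}) * ν (codimAt n ⁻¹' {k})) atTop
        (𝓝 (μ {X | X ⊓ V F m = Z})) := by
    intro μ ν _ _ hμ hν
    have h1 := tendsto_measure_inter_codimAt hμ hE
    have h2 := tendsto_measure_inter_codimAt hν MeasurableSet.univ
    simp only [Set.univ_inter, measure_univ] at h2
    simpa using ENNReal.Tendsto.mul h1 (.inr ENNReal.one_ne_top) h2
      (.inr (measure_ne_top μ _))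
  refine tendsto_nhds_unique (key hμ hν) ((key hν hμ).congr' ?_)
  filter_upwards [eventually_ge_atTop m] with n hn
  have : {X : Gr F | X ⊓ V F m = Z} = {X | X ⊓ V F n ∈ {Y : Gr F | Y ⊓ V F m = Z}} := by
    ext X
    simp [inf_assoc, inf_eq_right.2 (V_mono F hn)]
  rw [this]
  exact (measure_inter_mul_comm μ ν k _).symm

/-- Double counting: all `q ^ n - 1` nonzero vectors of `V_n` are equally likely to lie in `X`, and
`X ∩ V_n` has `q ^ (n - codimAt n X)` elements. -/
theorem measure_mem_le (μ : Measure (Gr F)) [SMulInvariantMeasure (GLinf F) (Gr F) μ]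
    {v : Vinf F} (hv : v ≠ 0) {n : ℕ} (hn : n ≠ 0) :
    μ {X | v ∈ X} ≤ 2 * ∫⁻ X, ((Nat.card F : ENNReal)⁻¹) ^ codimAt n X ∂μ := by
  classical
  have := Fintype.ofFinite (V F n)
  have hq : 2 ≤ Nat.card F := Finite.one_lt_card
  have hq0 : (Nat.card F : ENNReal) ≠ 0 := by exact_mod_cast (by omega)
  let T : Finset (V F n) := Finset.univ.erase 0
  -- The constant 2 absorbs the removed zero vector: `q ^ n ≤ 2 * (q ^ n - 1)` because `q ^ n ≥ 2`.
  have hT : Nat.card F ^ n ≤ 2 * T.card := by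
    have h1 : T.card = Nat.card F ^ n - 1 := by
      rw [Finset.card_erase_of_mem (Finset.mem_univ _), Finset.card_univ,
        ← Nat.card_eq_fintype_card, Module.natCard_eq_pow_finrank (K := F), finrank_V]
    have h2 : Nat.card F ^ 1 ≤ Nat.card F ^ n := Nat.pow_le_pow_right (by omega) (by omega)
    rw [pow_one] at h2
    omega
  have hsum : T.card * μ {X | v ∈ X} = ∫⁻ X, ∑ w ∈ T, {X | (w : Vinf F) ∈ X}.indicator 1 X ∂μ := by
    rw [lintegral_finsetSum _ fun w _ => measurable_one.indicator (measurableSet_mem _),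
      Finset.sum_congr rfl fun w _ => lintegral_indicator_one (measurableSet_mem _),
      Finset.sum_congr rfl fun w hw => measure_mem_eq (w := v) (by simpa [T] using hw) hv,
      Finset.sum_const, nsmul_eq_mul]
  have hpt : ∀ X : Gr F, ∑ w ∈ T, {X : Gr F | (w : Vinf F) ∈ X}.indicator (1 : Gr F → ENNReal) X ≤
      (Nat.card F) ^ n * ((Nat.card F : ENNReal)⁻¹) ^ codimAt n X := by
    intro X
    have h1 : (T.filter fun w : V F n => (w : Vinf F) ∈ X).card ≤
        Nat.card F ^ Module.finrank F (X ⊓ V F n : Gr F) := by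
      have : FiniteDimensional F (X ⊓ V F n : Gr F) :=
        Submodule.finiteDimensional_of_le inf_le_right
      have : Finite (X ⊓ V F n : Gr F) := Module.finite_of_finite F
      rw [← Module.natCard_eq_pow_finrank (K := F) (V := (X ⊓ V F n : Gr F))]
      have := Nat.card_le_card_of_injective
        (fun w : T.filter fun w : V F n => (w : Vinf F) ∈ X =>
          (⟨w.1.1, (Finset.mem_filter.1 w.2).2, w.1.2⟩ : (X ⊓ V F n : Gr F)))
        fun w w' h => Subtype.ext (Subtype.ext (Subtype.mk.inj h))
      rwa [Nat.card_eq_fintype_card, Fintype.card_coe] at this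
    have h2 : (Nat.card F : ENNReal) ^ n * ((Nat.card F : ENNReal)⁻¹) ^ codimAt n X =
        (Nat.card F : ENNReal) ^ Module.finrank F (X ⊓ V F n : Gr F) := by
      nth_rw 1 [← codimAt_add_finrank n X]
      rw [pow_add, mul_right_comm, ← mul_pow, ENNReal.mul_inv_cancel hq0 (by simp), one_pow,
        one_mul]
    rw [h2]
    simp only [Set.indicator_apply, Set.mem_ofPred_eq, Pi.one_apply, Finset.sum_boole]
    exact_mod_cast h1
  have hqn : (Nat.card F : ENNReal) ^ n ≠ 0 := pow_ne_zero _ hq0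
  have hqn' : (Nat.card F : ENNReal) ^ n ≠ ⊤ := ENNReal.pow_ne_top (by simp)
  rw [← ENNReal.mul_le_mul_iff_right hqn hqn']
  calc (Nat.card F : ENNReal) ^ n * μ {X | v ∈ X} ≤ (2 * T.card : ℕ) * μ {X | v ∈ X} := by
        gcongr; exact_mod_cast hT
    _ = 2 * (T.card * μ {X | v ∈ X}) := by push_cast; ring
    _ ≤ 2 * ∫⁻ X, (Nat.card F) ^ n * ((Nat.card F : ENNReal)⁻¹) ^ codimAt n X ∂μ := by
        rw [hsum]; gcongr with X; exact hpt X
    _ = _ := by rw [lintegral_const_mul' _ _ hqn']; ring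

theorem eq_dirac_of_ae_eq {α : Type*} [MeasurableSpace α] {μ : Measure α} [IsProbabilityMeasure μ]
    {a : α} (h : ∀ᵐ x ∂μ, x = a) : μ = Measure.dirac a := by
  calc μ = μ.map id := Measure.map_id.symm
    _ = μ.map fun _ => a := Measure.map_congr h
    _ = Measure.dirac a := by simp

theorem eq_dirac_bot {μ : Measure (Gr F)} [IsProbabilityMeasure μ]
    [SMulInvariantMeasure (GLinf F) (Gr F) μ] (h : ∀ᵐ X ∂μ, ∀ k : ℕ, codim F X ≠ k) :
    μ = Measure.dirac ⊥ := by
  have hlim : Tendsto (fun n => 2 * ∫⁻ X, ((Nat.card F : ENNReal)⁻¹) ^ codimAt n X ∂μ) atTop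
      (𝓝 0) := by
    have hq : (Nat.card F : ENNReal)⁻¹ < 1 := by
      rw [ENNReal.inv_lt_one]
      exact_mod_cast Finite.one_lt_card (α := F)
    have h1 := tendsto_lintegral_of_dominated_convergence (μ := μ)
      (F := fun n X => ((Nat.card F : ENNReal)⁻¹) ^ codimAt n X) (f := fun _ => 0) (fun _ => 1)
      (fun n => (measurable_from_top (f := fun j : ℕ => ((Nat.card F : ENNReal)⁻¹) ^ j)).comp
        (measurable_codimAt n))
      (fun n => ae_of_all _ fun X => pow_le_one₀ zero_le hq.le) (by simp)
      (h.mono fun X hX => (ENNReal.tendsto_pow_atTop_nhds_zero_of_lt_one hq).comp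
        (tendsto_codimAt_atTop hX))
    simpa using ENNReal.Tendsto.const_mul h1 (.inr ENNReal.ofNat_ne_top)
  have hmem : ∀ v : Vinf F, v ≠ 0 → ∀ᵐ X ∂μ, v ∉ X := by
    intro v hv
    have h0 : μ {X | v ∈ X} = 0 := by
      refine le_antisymm (ge_of_tendsto hlim ?_) zero_le
      filter_upwards [eventually_ne_atTop 0] with n hn
      exact measure_mem_le μ hv hn
    simpa [ae_iff] using h0
  refine eq_dirac_of_ae_eq ?_
  have hmem' : ∀ᵐ X ∂μ, ∀ v : Vinf F, v ≠ 0 → v ∉ X :=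
    ae_all_iff.2 fun v => by
      by_cases hv : v = 0
      · simp [hv]
      · simpa [hv] using hmem v hv
  filter_upwards [hmem'] with X hX
  rw [Submodule.eq_bot_iff]
  intro v hv
  by_contra hne
  exact hX v hne hv

theorem smulInvariant_dirac {X : Gr F} (hX : ∀ g : GLinf F, g • X = X) :
    SMulInvariantMeasure (GLinf F) (Gr F) (Measure.dirac X) where
  measure_preimage_smul g s hs := by
    rw [Measure.dirac_apply' _ hs, Measure.dirac_apply' _ (measurable_smul_Gr g hs)]
    have h : X ∈ (fun Y => g • Y) ⁻¹' s ↔ X ∈ s := by rw [Set.mem_preimage, hX g]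
    by_cases hs : X ∈ s
    · rw [Set.indicator_of_mem hs, Set.indicator_of_mem (h.2 hs)]
    · rw [Set.indicator_of_notMem hs, Set.indicator_of_notMem (mt h.1 hs)]

theorem isErgodicInvariant_dirac {X : Gr F} (hX : ∀ g : GLinf F, g • X = X) :
    IsErgodicInvariant F (Measure.dirac X) := by
  have := smulInvariant_dirac hX
  refine ⟨inferInstance, ⟨fun {s} hs _ => ?_⟩⟩
  rw [eventuallyConst_set]
  by_cases h : X ∈ s
  · exact .inl ((ae_dirac_iff hs).2 h)
  · exact .inr ((ae_dirac_iff hs.compl).2 h)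

/-- An invariant probability measure on the subspaces of codimension `k` is ergodic. -/
theorem isErgodicInvariant_of_codim_eq {μ : Measure (Gr F)} [IsProbabilityMeasure μ]
    [SMulInvariantMeasure (GLinf F) (Gr F) μ] {k : ℕ} (hμ : μ {X | codim F X = k}ᶜ = 0) :
    IsErgodicInvariant F μ := by
  refine ⟨inferInstance, ⟨fun {s} hs hinv => ?_⟩⟩
  rw [eventuallyConst_set]
  by_cases h0 : μ s = 0
  · exact .inr (measure_eq_zero_iff_ae_notMem.1 h0)
  left
  let ν : Measure (Gr F) := ProbabilityTheory.cond μ s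
  have : IsProbabilityMeasure ν := ProbabilityTheory.cond_isProbabilityMeasure h0
  -- Almost invariance of `s` makes the conditioned measure invariant, so uniqueness forces it to
  -- equal `μ`.
  have hν : SMulInvariantMeasure (GLinf F) (Gr F) ν := ⟨fun g t ht => by
    simp only [ν, ProbabilityTheory.cond_apply hs]
    congr 1
    rw [← SMulInvariantMeasure.measure_preimage_smul g (hs.inter ht), Set.preimage_inter]
    exact measure_congr ((hinv g).symm.inter (ae_eq_refl _))⟩
  have hνk : ν {X | codim F X = k}ᶜ = 0 := ProbabilityTheory.cond_absolutelyContinuous hμ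
  rw [eq_of_codim_eq hμ hνk]
  exact ProbabilityTheory.ae_cond_mem hs

theorem exists_codim_eq_or_eq_dirac {μ : Measure (Gr F)} (hμ : IsErgodicInvariant F μ) :
    (∃ k : ℕ, μ {X | codim F X = k}ᶜ = 0) ∨ μ = Measure.dirac ⊥ := by
  obtain ⟨_, hμ⟩ := hμ
  by_cases h : ∃ k : ℕ, μ {X | codim F X = k}ᶜ = 0
  · exact .inl h
  push Not at h
  refine .inr (eq_dirac_bot (ae_all_iff.2 fun k => ?_))
  have hinv : ∀ g : GLinf F, (fun X : Gr F => g • X) ⁻¹' {X | codim F X = k} =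
      {X | codim F X = k} := fun g => by
    ext X
    simp [codim_smul]
  have := hμ.aeconst_of_forall_preimage_smul_ae_eq (measurableSet_codim_eq k)
    fun g => (hinv g).eventuallyEq
  rw [eventuallyConst_set] at this
  exact this.resolve_left fun h' => h k h'

end Invariant

end QGrassmannian

namespace QGrassmannian

open Filter Topology

/-! ### Existence: kernels of Haar-random maps -/

section Kernel

variable {F : Type*} [Field F] {k : ℕ}

/-- The kernel of the linear map `V_∞ → F^k` with prescribed values at the basis vectors. -/
noncomputable def kernel (φ : ℕ → Fin k → F) : Gr F := (Finsupp.linearCombination F φ).ker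

/-- The hypothesis says that no hyperplane contains all the `φ i`, so the map is onto. -/
theorem codim_kernel {φ : ℕ → Fin k → F}
    (h : ∀ l : Module.Dual F (Fin k → F), l ≠ 0 → ∃ i, l (φ i) ≠ 0) : codim F (kernel φ) = k := by
  have hr : (Finsupp.linearCombination F φ).range = ⊤ := by
    by_contra hne
    obtain ⟨l, hl, hle⟩ := Submodule.exists_le_ker_of_lt_top _ (lt_top_iff_ne_top.2 hne)
    obtain ⟨i, hi⟩ := h l hl
    exact hi (hle ⟨Finsupp.single i 1, by simp⟩)
  have h1 := (Finsupp.linearCombination F φ).quotKerEquivRange.lift_rank_eq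
  rw [hr, rank_top, rank_fin_fun, Cardinal.lift_natCast, Cardinal.lift_id] at h1
  exact h1

/-- The action of `𝒢_∞` on sequences of vectors in `F^k`, corresponding to the action on
linear maps `V_∞ → F^k`. -/
noncomputable def actHom (g : GLinf F) : (ℕ → Fin k → F) →+ (ℕ → Fin k → F) where
  toFun φ i := Finsupp.linearCombination F φ ((g : Vinf F ≃ₗ[F] Vinf F).symm (Finsupp.single i 1))
  map_zero' := by
    ext i; simp
  map_add' φ ψ := by
    ext i; simp [Finsupp.linearCombination_apply, Finsupp.sum_add]

theorem linearCombination_actHom (g : GLinf F) (φ : ℕ → Fin k → F) (v : Vinf F) :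
    Finsupp.linearCombination F (actHom g φ) v =
      Finsupp.linearCombination F φ ((g : Vinf F ≃ₗ[F] Vinf F).symm v) := by
  have : Finsupp.linearCombination F (actHom g φ) = Finsupp.linearCombination F φ ∘ₗ
      ((g : Vinf F ≃ₗ[F] Vinf F).symm : Vinf F →ₗ[F] Vinf F) := by
    ext i : 2
    simp [actHom]
  exact LinearMap.congr_fun this v

theorem actHom_surjective (g : GLinf F) : Function.Surjective (actHom (k := k) g) := by
  intro φ
  refine ⟨actHom g⁻¹ φ, funext fun i => ?_⟩
  change Finsupp.linearCombination F (actHom g⁻¹ φ) _ = φ i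
  rw [linearCombination_actHom]
  have : ((g⁻¹ : GLinf F) : Vinf F ≃ₗ[F] Vinf F).symm
      ((g : Vinf F ≃ₗ[F] Vinf F).symm (Finsupp.single i 1)) = Finsupp.single i 1 :=
    (g : Vinf F ≃ₗ[F] Vinf F).apply_symm_apply _
  rw [this]
  simp

theorem kernel_actHom (g : GLinf F) (φ : ℕ → Fin k → F) : kernel (actHom g φ) = g • kernel φ := by
  ext v
  rw [mem_smul_iff]
  simp only [kernel, LinearMap.mem_ker, linearCombination_actHom]

variable [TopologicalSpace F] [DiscreteTopology F]

theorem continuous_linearCombination (v : Vinf F) :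
    Continuous fun φ : ℕ → Fin k → F => Finsupp.linearCombination F φ v := by
  simp only [Finsupp.linearCombination_apply, Finsupp.sum]
  fun_prop

variable [Finite F] [MeasurableSpace F] [BorelSpace F]

theorem measurable_kernel : Measurable (kernel (F := F) (k := k)) := by
  refine measurable_of_measurableSet_mem fun v => ?_
  have : Measurable fun φ : ℕ → Fin k → F => Finsupp.linearCombination F φ v :=
    (continuous_linearCombination v).measurable
  exact this (measurableSet_singleton 0)

theorem ae_codim_kernel (m : Measure (ℕ → Fin k → F)) [IsProbabilityMeasure m]
    [m.IsAddHaarMeasure] : ∀ᵐ φ ∂m, codim F (kernel φ) = k := by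
  have key : ∀ l : Module.Dual F (Fin k → F), l ≠ 0 → ∀ᵐ φ ∂m, ∃ i, l (φ i) ≠ 0 := by
    intro l hl
    obtain ⟨u, hu⟩ : ∃ u, l u ≠ 0 := by
      by_contra! h
      exact hl (LinearMap.ext h)
    have hlm : Measurable l := (continuous_of_discreteTopology (f := l)).measurable
    -- Shifting the `n`-th coordinate by `u` gives infinitely many disjoint translates of one set,
    -- all of equal mass in a probability space; that mass is therefore 0.
    let H : ℕ → Set (ℕ → Fin k → F) := fun n =>
      (fun φ => φ + Pi.single n u) ⁻¹' {φ | ∀ i, l (φ i) = 0}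
    have h0 : MeasurableSet {φ : ℕ → Fin k → F | ∀ i, l (φ i) = 0} := by
      simp only [Set.ofPred_forall]
      exact MeasurableSet.iInter fun i =>
        (hlm.comp (measurable_pi_apply i)) (measurableSet_singleton 0)
    have hH : ∀ n, MeasurableSet (H n) := fun n => (measurable_add_const _) h0
    have hmH : ∀ n, m (H n) = m {φ | ∀ i, l (φ i) = 0} := fun n =>
      measure_preimage_add_right m _ _
    have hd : Pairwise (Function.onFun Disjoint H) := by
      intro a b hab
      refine Set.disjoint_left.2 fun φ h1 h2 => hu ?_
      have h3 := h1 a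
      have h4 := h2 a
      simp only [Pi.add_apply, Pi.single_eq_same, map_add, Pi.single_eq_of_ne hab,
        add_zero] at h3 h4
      simpa [h4] using h3
    have hle := (tsum_meas_le_meas_iUnion_of_disjoint m hH hd).trans prob_le_one
    simp only [hmH] at hle
    have hz : m {φ | ∀ i, l (φ i) = 0} = 0 := by
      by_contra hne
      rw [ENNReal.tsum_const_eq_top_of_ne_zero hne] at hle
      simp at hle
    simpa [ae_iff] using hz
  have : Finite (Module.Dual F (Fin k → F)) := Module.finite_of_finite F
  have key' : ∀ᵐ φ ∂m, ∀ l : Module.Dual F (Fin k → F), l ≠ 0 → ∃ i, l (φ i) ≠ 0 :=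
    ae_all_iff.2 fun l => by
      by_cases hl : l = 0
      · simp [hl]
      · simpa [hl] using key l hl
  filter_upwards [key'] with φ hφ using codim_kernel hφ

/-- A continuous surjective endomorphism of a compact group preserves Haar measure, and `kernel`
intertwines the two actions. -/
theorem smulInvariant_map_kernel (m : Measure (ℕ → Fin k → F)) [m.IsAddHaarMeasure] :
    SMulInvariantMeasure (GLinf F) (Gr F) (m.map kernel) where
  measure_preimage_smul g s hs := by
    have hmp : MeasurePreserving (actHom (k := k) g) m m :=
      AddMonoidHom.measurePreserving (continuous_pi fun i => continuous_linearCombination _)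
        (actHom_surjective g) rfl
    rw [Measure.map_apply measurable_kernel hs,
      Measure.map_apply measurable_kernel (measurable_smul_Gr g hs),
      ← hmp.measure_preimage (measurable_kernel hs).nullMeasurableSet]
    congr 1
    ext φ
    simp [kernel_actHom]

end Kernel

/-- For every `k` there is an invariant probability measure on the subspaces of codimension `k`. -/
theorem exists_invariant_codim_eq (F : Type*) [Field F] [Finite F] (k : ℕ) :
    ∃ μ : Measure (Gr F), IsProbabilityMeasure μ ∧ SMulInvariantMeasure (GLinf F) (Gr F) μ ∧
      μ {X | codim F X = k}ᶜ = 0 := by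
  let : TopologicalSpace F := ⊥
  have : DiscreteTopology F := ⟨rfl⟩
  let : MeasurableSpace F := borel F
  have : BorelSpace F := ⟨rfl⟩
  -- The sequence space is compact, so normalising on `⊤` gives total mass 1.
  let m : Measure (ℕ → Fin k → F) := Measure.addHaarMeasure ⊤
  have : IsProbabilityMeasure m :=
    ⟨Measure.addHaarMeasure_self (K₀ := (⊤ : TopologicalSpace.PositiveCompacts _))⟩
  refine ⟨m.map kernel, Measure.isProbabilityMeasure_map measurable_kernel.aemeasurable,
    smulInvariant_map_kernel m, ?_⟩
  rw [Measure.map_apply measurable_kernel (measurableSet_codim_eq k).compl]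
  exact ae_codim_kernel m

end QGrassmannian

/-! ### The classification -/

open QGrassmannian in
theorem mainTheorem6 (F : Type*) [Field F] [Finite F] :
    ∃! P : ℕ∞ → MeasureTheory.Measure (QGrassmannian.Gr F),
      Set.BijOn P Set.univ {μ | QGrassmannian.IsErgodicInvariant F μ} ∧
      P 0 = MeasureTheory.Measure.dirac ⊤ ∧
      P ⊤ = MeasureTheory.Measure.dirac ⊥ ∧
      ∀ k : ℕ, 0 < k →
        P (k : ℕ∞) {X : QGrassmannian.Gr F | QGrassmannian.codim F X = (k : Cardinal)}ᶜ = 0 := by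
  choose p hprob hinv hcodim using exists_invariant_codim_eq F
  have hbot : ∀ k : ℕ, codim F ⊥ ≠ k := by
    intro k h
    have h1 := (Submodule.quotEquivOfEqBot (⊥ : Gr F) rfl).rank_eq
    rw [← codim, h, rank_finsupp_self, Cardinal.mk_nat, Cardinal.lift_aleph0] at h1
    exact Cardinal.natCast_lt_aleph0.ne h1
  have htop : codim F ⊤ = (0 : ℕ) := by
    rw [codim, Nat.cast_zero, rank_subsingleton']
  have hbot_fixed : ∀ g : GLinf F, g • (⊥ : Gr F) = ⊥ := fun g => Submodule.map_bot _
  have htop_fixed : ∀ g : GLinf F, g • (⊤ : Gr F) = ⊤ := fun g =>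
    (Submodule.map_top _).trans (g : Vinf F ≃ₗ[F] Vinf F).range
  have h0 : p 0 = Measure.dirac ⊤ := by
    have := smulInvariant_dirac htop_fixed
    refine eq_of_codim_eq (hcodim 0) ?_
    rw [Measure.dirac_apply' _ (measurableSet_codim_eq 0).compl]
    simp [htop]
  have hne : ∀ (μ : Measure (Gr F)) [IsProbabilityMeasure μ] (j k : ℕ), j ≠ k →
      μ {X | codim F X = j}ᶜ = 0 → μ {X | codim F X = k}ᶜ ≠ 0 := by
    intro μ _ j k hjk hj hk
    have h1 : ∀ᵐ X ∂μ, codim F X = j := hj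
    have h2 : ∀ᵐ X ∂μ, codim F X = k := hk
    obtain ⟨X, hX, hX'⟩ := (h1.and h2).exists
    exact hjk (by exact_mod_cast hX.symm.trans hX')
  have hne_bot : ∀ k : ℕ, Measure.dirac ⊥ {X : Gr F | codim F X = k}ᶜ ≠ 0 := fun k => by
    rw [Measure.dirac_apply' _ (measurableSet_codim_eq k).compl]
    simp [hbot k]
  let P : ℕ∞ → Measure (Gr F) := fun κ => ENat.recTopCoe (Measure.dirac ⊥) p κ
  refine ⟨P, ⟨⟨?_, ?_, ?_⟩, h0, rfl, fun k _ => hcodim k⟩, ?_⟩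
  · rintro κ -
    induction κ using ENat.recTopCoe with
    | top => exact isErgodicInvariant_dirac hbot_fixed
    | coe k => exact isErgodicInvariant_of_codim_eq (μ := p k) (hcodim k)
  · rintro κ - κ' - h
    induction κ using ENat.recTopCoe with
    | top =>
      induction κ' using ENat.recTopCoe with
      | top => rfl
      | coe k => exact absurd (h ▸ hcodim k : P ⊤ _ = 0) (hne_bot k)
    | coe j =>
      induction κ' using ENat.recTopCoe with
      | top => exact absurd (h ▸ hcodim j : P ⊤ _ = 0) (hne_bot j)
      | coe k =>
        by_contra hjk
        have h' : p j = p k := h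
        exact hne (p j) j k (by exact_mod_cast hjk) (hcodim j) (h' ▸ hcodim k)
  · intro μ hμ
    have := hμ.1
    have := hμ.2.toSMulInvariantMeasure
    obtain ⟨k, hk⟩ | h := exists_codim_eq_or_eq_dirac hμ
    · exact ⟨k, trivial, eq_of_codim_eq (μ := p k) (hcodim k) hk⟩
    · exact ⟨⊤, trivial, h.symm⟩
  -- For `k > 0`, `Q k` is invariant and carried by codimension `k`, so `eq_of_codim_eq` determines
  -- it.
  · rintro Q ⟨hQ, hQ0, hQtop, hQk⟩
    funext κ
    induction κ using ENat.recTopCoe with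
    | top => exact hQtop
    | coe k =>
      obtain rfl | hk := Nat.eq_zero_or_pos k
      · exact hQ0.trans h0.symm
      · have he : IsErgodicInvariant F (Q k) := hQ.mapsTo (Set.mem_univ _)
        have := he.1
        have := he.2.toSMulInvariantMeasure
        exact eq_of_codim_eq (ν := p k) (hQk k hk) (hcodim k)
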